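/- Let $K$ be a number field with ring of integers $\mathcal O_K$, let $S$ be a finite set of nonzero prime ideals of $\mathcal O_K$, and let $T\subseteq\mathcal O_K$ be a nonempty set defined by congruence conditions at $S$: there are exponents $e_{\mathfrak p}\ge 0$ $(\mathfrak p\in S)$ such that whether $b\in T$ depends only on the residues of $b$ modulo $\mathfrak p^{e_{\mathfrak p}}$, $\mathfrak p\in S$. Let $k\ge 0$, let $c_1,\dots,c_k,d_1,\dots,d_k\in\mathcal O_K$, and put $A(x)=\prod_{i=1}^k(c_ix+d_i)$. Suppose that $A(x)$ is squarefree as a polynomial in $K[x]$. For a nonzero prime $\mathfrak p$ of $\mathcal O_K$ let \[ a(\mathfrak p)=\frac{\#\{b\in\mathcal O_K/\mathfrak p^2 : A(b)\not\equiv 0 \pmod{\mathfrak p^2}\}}{\#(\mathcal O_K/\mathfrak p^2)} . \] Call $a\in\mathcal O_K$ squarefree away from $S$ if $\mathfrak p^2\nmid (a)$ for every nonzero prime $\mathfrak p\notin S$. Let $q\in\{1,2\}$, and for $b\in K$ put $|b|=\sqrt{\sum_{\sigma}|\sigma(b)|^q}$, where $\sigma$ runs over all embeddings $K\to\mathbb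 C$. Then the product $\prod_{\mathfrak p\notin S}a(\mathfrak p)$ converges unconditionally (possibly to $0$), and, for real $N$, \[ \lim_{N\to\infty}\frac{\#\{b\in T : |b|\le N \text{ and } A(b)\text{ is squarefree away from } S\}}{\#\{b\in T : |b|\le N\}}=\prod_{\mathfrak p\notin S}a(\mathfrak p). \] If moreover $a(\mathfrak p)>0$ for all $\mathfrak p\notin S$, then $\prod_{\mathfrak p\notin S}a(\mathfrak p)>0$. -/

import Mathlib

open Filter Topology Polynomial NumberField IsDedekindDomain

noncomputable section

namespace SquarefreeSieve

variable {K : Type*} [Field K] [NumberField K]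

/-- `T` is defined by congruence conditions at the finite set `S` of primes: for suitable exponents,
membership of `b` in `T` depends only on the residues of `b` modulo the powers `p ^ e p`, `p ∈ S`. -/
def DefinedByCongruencesAt (S : Finset (HeightOneSpectrum (𝓞 K))) (T : Set (𝓞 K)) : Prop :=
  ∃ e : HeightOneSpectrum (𝓞 K) → ℕ, ∀ b b' : 𝓞 K,
    (∀ p ∈ S, b - b' ∈ p.asIdeal ^ e p) → (b ∈ T ↔ b' ∈ T)

/-- The polynomial `A(x) = ∏ i, (c i * x + d i)`. -/
def prodLinear {k : ℕ} (c d : Fin k → 𝓞 K) : (𝓞 K)[X] :=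
  ∏ i, (C (c i) * X + C (d i))

/-- `a ∈ 𝓞 K` is squarefree away from `S`: no prime `p ∉ S` has `p ^ 2` dividing the ideal `(a)`.
In particular `0` is not squarefree away from `S`. -/
def SquarefreeAway (S : Finset (HeightOneSpectrum (𝓞 K))) (a : 𝓞 K) : Prop :=
  ∀ p : HeightOneSpectrum (𝓞 K), p ∉ S → ¬ p.asIdeal ^ 2 ∣ Ideal.span {a}

/-- The proportion of residue classes `b` modulo `p ^ 2` with `A(b) ≢ 0` modulo `p ^ 2`. -/
def localDensity (A : (𝓞 K)[X]) (p : HeightOneSpectrum (𝓞 K)) : ℝ :=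
  (Nat.card {b : 𝓞 K ⧸ p.asIdeal ^ 2 //
      (A.map (Ideal.Quotient.mk (p.asIdeal ^ 2))).eval b ≠ 0} : ℝ) /
    (Nat.card (𝓞 K ⧸ p.asIdeal ^ 2) : ℝ)

/-- The size `√(∑ σ, |σ b| ^ q)`, the sum running over all embeddings of `K` into `ℂ`. -/
def size (q : ℕ) (b : K) : ℝ :=
  Real.sqrt (∑ σ : K →+* ℂ, ‖σ b‖ ^ q)

/-- Only finitely many integers have bounded size, so that counting them is meaningful. -/
theorem finite_size_le {q : ℕ} (hq : q ≠ 0) (N : ℝ) :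
    {b : 𝓞 K | size q (b : K) ≤ N}.Finite := by
  have h := NumberField.Embeddings.finite_of_norm_le K ℂ (max 1 (N ^ 2))
  refine Set.Finite.of_finite_image (f := fun b : 𝓞 K => (b : K)) (h.subset ?_)
    (RingOfIntegers.coe_injective.injOn)
  rintro _ ⟨b, hb, rfl⟩
  refine ⟨b.isIntegral_coe, fun σ => ?_⟩
  have hN : (0 : ℝ) ≤ N := (Real.sqrt_nonneg _).trans hb
  have h1 : ∑ τ : K →+* ℂ, ‖τ (b : K)‖ ^ q ≤ N ^ 2 := (Real.sqrt_le_left hN).1 hb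
  have h2 : ‖σ (b : K)‖ ^ q ≤ N ^ 2 :=
    (Finset.single_le_sum (f := fun τ : K →+* ℂ => ‖τ (b : K)‖ ^ q)
      (fun _ _ => by positivity) (Finset.mem_univ σ)).trans h1
  by_cases h3 : ‖σ (b : K)‖ ≤ 1
  · exact h3.trans (le_max_left _ _)
  · exact ((le_self_pow₀ (not_le.1 h3).le hq).trans h2).trans (le_max_right _ _)

end SquarefreeSieve

end

/-! For finitely many primes, the Chinese remainder theorem and the equidistribution of residue
classes in balls give the density of `T` times a finite product of local densities
(`exists_tendsto_proportion_inter`). The difficulty is the tail: the `b` with `p ^ 2 ∣ A(b)` for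
some prime `p` outside a large finite set must be rare, uniformly in the radius.

Since the factors of `A` are linear, this can be done directly. Squarefreeness of `A` makes the
forms coprime modulo all but finitely many `p`, so `p ^ 2 ∣ A(b)` forces `p ^ 2` to divide a single
nonconstant form (`exists_finset_forall_eval_mem`). For one form the `b` with value in `J` are
separated by a distance of order `N(J) ^ (1 / n)`, where `n = [K : ℚ]`. A nonzero value in `J` has
norm at least `N(J)`, so none occurs when the ball is too small compared with `J`. Packing disjoint
balls then bounds the proportion by `O(N(J)⁻¹)`, uniformly in `J` and the radius
(`exists_proportion_linear_le`). As `∑ N(p)⁻²` converges, the tail is small. The same bound gives `1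
- a(p) = O(N(p)⁻²)`, hence the convergence of the product, and its nonvanishing when no factor is
zero. -/

noncomputable section

namespace SquarefreeSieve

set_option linter.unusedSectionVars false

/-! ### Lattice points in dilated convex bodies -/

section LatticeCount

open MeasureTheory Pointwise

/-- The number of integer points `z` with `‖f z‖ ≤ R`, for an injective linear map `f`, grows like a
positive multiple of `R ^ card ι`. -/
theorem exists_tendsto_card_norm_le {ι : Type*} [Fintype ι] {E : Type*} [NormedAddCommGroup E]
    [NormedSpace ℝ E] (f : (ι → ℝ) →ₗ[ℝ] E) (hf : Function.Injective f) :
    ∃ V : ℝ, 0 < V ∧ Tendsto (fun R : ℝ =>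
      (Nat.card {z : ι → ℤ // ‖f (fun i => (z i : ℝ))‖ ≤ R} : ℝ) / R ^ Fintype.card ι)
      atTop (𝓝 V) := by
  classical
  have hcont : Continuous f := f.continuous_of_finiteDimensional
  set s : Set (ι → ℝ) := f ⁻¹' Metric.closedBall 0 1 with hs
  have hmem : ∀ v, v ∈ s ↔ ‖f v‖ ≤ 1 := fun v => by simp [hs]
  have hconv : Convex ℝ s := (convex_closedBall (0 : E) 1).linear_preimage f
  have hclosed : IsClosed s := Metric.isClosed_closedBall.preimage hcont
  have hbdd : Bornology.IsBounded s := by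
    obtain ⟨C, -, hC⟩ := f.exists_antilipschitzWith (LinearMap.ker_eq_bot.2 hf)
    exact hC.isBounded_preimage Metric.isBounded_closedBall
  have hpos : 0 < volume s := by
    refine Measure.measure_pos_of_mem_nhds volume (x := 0) ?_
    refine hcont.continuousAt.preimage_mem_nhds ?_
    rw [map_zero]
    exact Metric.closedBall_mem_nhds 0 one_pos
  have hlt : volume s < ⊤ := hbdd.measure_lt_top
  refine ⟨volume.real s, ENNReal.toReal_pos hpos.ne' hlt.ne, ?_⟩
  refine (tendsto_card_div_pow_atTop_volume' s hbdd hclosed.measurableSet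
    (hconv.addHaar_frontier volume) ?_).congr' ?_
  -- The limit over real `R` needs the dilates of `s` to increase.
  · intro x y hx hxy v hv
    rw [Set.mem_smul_set_iff_inv_smul_mem₀ hx.ne', hmem, map_smul, norm_smul] at hv
    rw [Set.mem_smul_set_iff_inv_smul_mem₀ (hx.trans_le hxy).ne', hmem, map_smul, norm_smul]
    refine le_trans ?_ hv
    rw [norm_inv, norm_inv, Real.norm_of_nonneg hx.le, Real.norm_of_nonneg (hx.le.trans hxy)]
    gcongr
  · filter_upwards [eventually_gt_atTop 0] with R hR
    congr 2
    refine (Nat.card_congr (Equiv.ofBijective (fun z : {z : ι → ℤ // ‖f (fun i => (z i : ℝ))‖ ≤ R} =>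
      (⟨R⁻¹ • (fun i => (z.1 i : ℝ)), ?_, ?_⟩ :
        ↥(s ∩ R⁻¹ • (Submodule.span ℤ (Set.range (Pi.basisFun ℝ ι)) : Set (ι → ℝ))))) ⟨?_, ?_⟩)).symm
    · rw [hmem, map_smul, norm_smul, norm_inv, Real.norm_of_nonneg hR.le, inv_mul_le_iff₀ hR,
        mul_one]
      exact z.2
    · refine Set.smul_mem_smul_set ?_
      rw [SetLike.mem_coe, Module.Basis.mem_span_iff_repr_mem]
      intro i
      simp
    · intro z w h
      have h1 := smul_right_injective (ι → ℝ) (inv_ne_zero hR.ne') (Subtype.ext_iff.1 h)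
      ext i
      exact_mod_cast congrFun h1 i
    · rintro ⟨v, hv, w, hw, rfl⟩
      rw [SetLike.mem_coe, Module.Basis.mem_span_iff_repr_mem] at hw
      choose z hz using hw
      have hzw : (fun i => (z i : ℝ)) = w := by
        ext i
        simpa using hz i
      rw [hmem] at hv
      simp only [map_smul, norm_smul, norm_inv, Real.norm_of_nonneg hR.le] at hv
      rw [inv_mul_le_iff₀ hR, mul_one] at hv
      refine ⟨⟨z, by rwa [hzw]⟩, ?_⟩
      simp [hzw]

end LatticeCount

variable {K : Type*} [Field K] [NumberField K]

/-! ### Summability of `N(p)⁻²` -/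

/-- The primes of `𝓞 K` satisfy `∑ N(p)⁻² < ∞`. -/
theorem summable_absNorm_inv_sq :
    Summable (fun p : HeightOneSpectrum (𝓞 K) => ((Ideal.absNorm p.asIdeal : ℝ) ^ 2)⁻¹) := by
  set g : ℕ → ℝ := fun n => (Nat.card {I : Ideal (𝓞 K) // Ideal.absNorm I = n} : ℝ) with hg
  have hlim : Tendsto (fun n : ℕ => (∑ k ∈ Finset.Icc 1 n, g k) / (n : ℝ)) atTop
      (𝓝 (dedekindZeta_residue K)) := by
    refine ((NumberField.Ideal.tendsto_norm_le_div_atTop₀ K).comp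
      tendsto_natCast_atTop_atTop).congr fun n ↦ ?_
    simp only [Function.comp_apply, Nat.cast_le, ← Nat.cast_sum, hg]
    congr
    -- The limit counts nonzero ideals; the zero ideal, the only one of norm 0, is added to both
    -- sides.
    rw [← add_left_inj 1, ← Ideal.card_norm_le_eq_card_norm_le_add_one,
      show Finset.Icc 1 n = Finset.Ioc 0 n from Finset.Icc_succ_left_eq_Ioc _ _,
      show 1 = Nat.card {I : Ideal (𝓞 K) // Ideal.absNorm I = 0} by
        simp [Ideal.absNorm_eq_zero_iff],
      Finset.sum_Ioc_add_eq_sum_Icc (n.zero_le),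
      ← Finset.card_preimage_eq_sum_card_image_eq
        (fun k _ ↦ Ideal.finite_setOfPred_absNorm_eq k)]
    simp [Set.coe_eq_subtype]
  have hO : (fun n : ℕ => ∑ k ∈ Finset.Icc 1 n, g k) =O[atTop] fun n : ℕ => (n : ℝ) ^ (1 : ℝ) := by
    simp only [Real.rpow_one]
    refine Asymptotics.isBigO_of_div_tendsto_nhds ?_ _ hlim
    filter_upwards [eventually_gt_atTop 0] with n hn h
    exact absurd h (by positivity)
  -- Partial sums of order `n` give convergence to the right of 1, in particular at 2.
  have hL := LSeriesSummable_of_sum_norm_bigO_and_nonneg (s := 2) hO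
    (fun n => Nat.cast_nonneg _) zero_le_one (by norm_num)
  have hsum : Summable (fun n : ℕ => g n * ((n : ℝ) ^ 2)⁻¹) := by
    refine hL.norm.congr fun n => ?_
    rcases eq_or_ne n 0 with rfl | hn
    · simp
    · rw [LSeries.term_of_ne_zero hn, norm_div]
      rw [show (2 : ℂ) = ((2 : ℕ) : ℂ) by norm_num, Complex.cpow_natCast]
      simp [hg, div_eq_mul_inv]
  have hI : Summable (fun I : Ideal (𝓞 K) => ((Ideal.absNorm I : ℝ) ^ 2)⁻¹) := by
    rw [← (Equiv.sigmaFiberEquiv (fun I : Ideal (𝓞 K) => Ideal.absNorm I)).summable_iff]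
    have hfin : ∀ n : ℕ, Finite {I : Ideal (𝓞 K) // Ideal.absNorm I = n} := fun n =>
      (Ideal.finite_setOfPred_absNorm_eq n).to_subtype
    rw [summable_sigma_of_nonneg (fun _ => by simp)]
    refine ⟨fun n => Summable.of_finite, hsum.congr fun n => ?_⟩
    have : ∀ x : {I : Ideal (𝓞 K) // Ideal.absNorm I = n},
        (((fun I : Ideal (𝓞 K) => ((Ideal.absNorm I : ℝ) ^ 2)⁻¹) ∘
          (Equiv.sigmaFiberEquiv (fun I : Ideal (𝓞 K) => Ideal.absNorm I))) ⟨n, x⟩ : ℝ) =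
          ((n : ℝ) ^ 2)⁻¹ := fun x => by
      simp [Equiv.sigmaFiberEquiv, x.2]
    rw [tsum_congr this]
    have := Fintype.ofFinite {I : Ideal (𝓞 K) // Ideal.absNorm I = n}
    rw [tsum_fintype]
    simp [hg]
  exact hI.comp_injective (i := fun p : HeightOneSpectrum (𝓞 K) => p.asIdeal)
    fun p p' h => HeightOneSpectrum.ext h

/-! ### Norms from the complex embeddings and the growth of their balls -/

/-- The `ℓ^q` norm of the vector of all complex conjugates, as a seminorm on the additive group. -/
def embeddingNorm (q : ℕ) [Fact (1 ≤ (q : ENNReal))] : AddGroupSeminorm (𝓞 K) :=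
  (normAddGroupSeminorm (PiLp (q : ENNReal) fun _ : K →+* ℂ => ℂ)).comp
    { toFun := fun b => WithLp.toLp _ (fun σ => σ (b : K))
      map_zero' := by ext; simp
      map_add' := fun a b => by ext; simp }

theorem embeddingNorm_apply (q : ℕ) [Fact (1 ≤ (q : ENNReal))] (b : 𝓞 K) :
    embeddingNorm q b =
      ‖(WithLp.toLp (q : ENNReal) (fun σ : K →+* ℂ => σ (b : K)) :
        PiLp (q : ENNReal) fun _ : K →+* ℂ => ℂ)‖ := rfl

/-- A seminorm on `𝓞 K` that dominates every complex absolute value and whose balls contain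
asymptotically a positive multiple of `R ^ [K : ℚ]` integers. -/
structure IsEmbeddingNorm (ν : AddGroupSeminorm (𝓞 K)) : Prop where
  norm_le : ∀ (σ : K →+* ℂ) (b : 𝓞 K), ‖σ (b : K)‖ ≤ ν b
  exists_tendsto : ∃ V : ℝ, 0 < V ∧ Tendsto (fun R : ℝ =>
    (({b | ν b ≤ R} : Set (𝓞 K)).ncard : ℝ) / R ^ Module.finrank ℚ K) atTop (𝓝 V)

/-- In integral coordinates the vector of conjugates is the restriction to integer points of a
real-linear map. That map is injective because the conjugate vectors of an integral basis are
independent over `ℂ`, hence over `ℝ`, so the lattice point count applies. -/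
theorem isEmbeddingNorm_embeddingNorm (q : ℕ) [Fact (1 ≤ (q : ENNReal))] :
    IsEmbeddingNorm (embeddingNorm (K := K) q) := by
  refine ⟨fun σ b => ?_, ?_⟩
  · rw [embeddingNorm_apply]
    exact PiLp.norm_apply_le (p := (q : ENNReal)) (WithLp.toLp (q : ENNReal) (fun σ : K →+* ℂ => σ (b : K))) σ
  · set ω := RingOfIntegers.basis K
    set B := canonicalEmbedding.latticeBasis K
    let f : (Module.Free.ChooseBasisIndex ℤ (𝓞 K) → ℝ) →ₗ[ℝ]
        PiLp (q : ENNReal) fun _ : K →+* ℂ => ℂ :=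
      (WithLp.linearEquiv (q : ENNReal) ℝ ((K →+* ℂ) → ℂ)).symm.toLinearMap ∘ₗ
        Fintype.linearCombination ℝ (fun i => B i)
    have hf : Function.Injective f := by
      refine (WithLp.linearEquiv (q : ENNReal) ℝ ((K →+* ℂ) → ℂ)).symm.injective.comp ?_
      have : LinearIndependent ℝ (fun i => B i) := B.linearIndependent.restrict_scalars
        (by simpa only [Complex.real_smul, mul_one] using Complex.ofReal_injective)
      exact this.fintypeLinearCombination_injective
    obtain ⟨V, hV, h⟩ := exists_tendsto_card_norm_le f hf
    refine ⟨V, hV, h.congr fun R => ?_⟩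
    rw [show Fintype.card (Module.Free.ChooseBasisIndex ℤ (𝓞 K)) = Module.finrank ℚ K by
      rw [← RingOfIntegers.rank, Module.finrank_eq_card_chooseBasisIndex]]
    congr 2
    rw [← Nat.card_coe_set_eq]
    refine (Nat.card_congr (ω.equivFun.toEquiv.subtypeEquiv fun b => ?_)).symm
    rw [Set.mem_ofPred_eq, embeddingNorm_apply]
    suffices hfb : f (fun i => ((ω.equivFun b i : ℤ) : ℝ)) =
        WithLp.toLp (q : ENNReal) (fun σ : K →+* ℂ => σ (b : K)) by
      rw [← hfb]; rfl
    simp only [f, LinearMap.comp_apply, Fintype.linearCombination_apply]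
    ext σ
    have hb : (b : K) = ∑ i, (ω.equivFun b i : ℤ) • (integralBasis K i) := by
      conv_lhs => rw [← ω.sum_equivFun b]
      simp [ω, integralBasis_apply]
    rw [hb]
    simp [B, canonicalEmbedding.latticeBasis_apply]

variable {ν : AddGroupSeminorm (𝓞 K)}

namespace IsEmbeddingNorm

theorem finite_ball (hν : IsEmbeddingNorm ν) (R : ℝ) : ({b | ν b ≤ R} : Set (𝓞 K)).Finite := by
  refine Set.Finite.of_finite_image (f := fun b : 𝓞 K => (b : K))
    ((NumberField.Embeddings.finite_of_norm_le K ℂ R).subset ?_)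
    RingOfIntegers.coe_injective.injOn
  rintro _ ⟨b, hb, rfl⟩
  exact ⟨b.isIntegral_coe, fun σ => (hν.norm_le σ b).trans hb⟩

theorem ncard_ball_pos (hν : IsEmbeddingNorm ν) {R : ℝ} (hR : 0 ≤ R) :
    0 < ({b | ν b ≤ R} : Set (𝓞 K)).ncard :=
  (Set.ncard_pos (hν.finite_ball R)).2 ⟨0, by simpa using hR⟩

/-- Growth like `R ^ n` makes a bounded change of radius negligible; this absorbs the boundary
effect of translations. -/
theorem tendsto_ncard_ball_add (hν : IsEmbeddingNorm ν) (C : ℝ) :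
    Tendsto (fun R : ℝ => (({b | ν b ≤ R + C} : Set (𝓞 K)).ncard : ℝ) /
      ({b | ν b ≤ R} : Set (𝓞 K)).ncard) atTop (𝓝 1) := by
  obtain ⟨V, hV, h⟩ := hν.exists_tendsto
  have h1 := h.comp (tendsto_atTop_add_const_right atTop C tendsto_id)
  have h2 : Tendsto (fun R : ℝ => ((R + C) / R) ^ Module.finrank ℚ K) atTop (𝓝 1) := by
    have : Tendsto (fun R : ℝ => 1 + C / R) atTop (𝓝 (1 + 0)) :=
      tendsto_const_nhds.add (tendsto_const_nhds.div_atTop tendsto_id)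
    rw [add_zero] at this
    have h3 := this.pow (Module.finrank ℚ K)
    rw [one_pow] at h3
    refine h3.congr' ?_
    filter_upwards [eventually_gt_atTop 0] with R hR
    rw [add_div, div_self hR.ne']
  have h4 := (h1.div h hV.ne').mul h2
  rw [div_self hV.ne', one_mul] at h4
  refine h4.congr' ?_
  filter_upwards [eventually_gt_atTop 0, eventually_gt_atTop (-C)] with R hR hRC
  have hRC' : 0 < R + C := by linarith
  have := hν.ncard_ball_pos hR.le
  simp only [Pi.div_apply, Function.comp_apply, id, div_pow]
  field_simp

/-- The bound reaches down to `R = 0` because the packing argument uses balls that may be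
arbitrarily small. -/
theorem exists_le_ncard_ball (hν : IsEmbeddingNorm ν) :
    ∃ κ : ℝ, 0 < κ ∧ ∀ R : ℝ, 0 ≤ R →
      κ * R ^ Module.finrank ℚ K ≤ ({b | ν b ≤ R} : Set (𝓞 K)).ncard := by
  obtain ⟨V, hV, h⟩ := hν.exists_tendsto
  obtain ⟨R₀, h0⟩ := eventually_atTop.1 (h.eventually_const_le (half_lt_self hV))
  set M := max R₀ 1
  have hM : 0 < M := lt_max_of_lt_right one_pos
  refine ⟨min (V / 2) (M ^ Module.finrank ℚ K)⁻¹, by positivity, fun R hR => ?_⟩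
  rcases le_total M R with hMR | hMR
  · have h1 := h0 R ((le_max_left _ _).trans hMR)
    rw [le_div_iff₀ (pow_pos (hM.trans_le hMR) _)] at h1
    refine le_trans ?_ h1
    gcongr
    exact min_le_left _ _
  -- Below `M` the single point 0 suffices.
  · calc _ ≤ (M ^ Module.finrank ℚ K)⁻¹ * M ^ Module.finrank ℚ K := by
          gcongr
          exact min_le_right _ _
      _ = 1 := inv_mul_cancel₀ (by positivity)
      _ ≤ _ := by exact_mod_cast hν.ncard_ball_pos hR

theorem exists_ncard_ball_le (hν : IsEmbeddingNorm ν) :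
    ∃ κ : ℝ, 0 < κ ∧ ∀ R : ℝ, 1 ≤ R →
      (({b | ν b ≤ R} : Set (𝓞 K)).ncard : ℝ) ≤ κ * R ^ Module.finrank ℚ K := by
  obtain ⟨V, hV, h⟩ := hν.exists_tendsto
  obtain ⟨R₀, h0⟩ := eventually_atTop.1 (h.eventually_le_const (lt_add_one V))
  refine ⟨max (V + 1) (({b | ν b ≤ R₀} : Set (𝓞 K)).ncard), by positivity, fun R hR => ?_⟩
  rcases le_total R₀ R with hRR | hRR
  · have h1 := h0 R hRR
    rw [div_le_iff₀ (by positivity)] at h1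
    refine h1.trans ?_
    gcongr
    exact le_max_left _ _
  · calc (({b | ν b ≤ R} : Set (𝓞 K)).ncard : ℝ) ≤ ({b | ν b ≤ R₀} : Set (𝓞 K)).ncard := by
          exact_mod_cast Set.ncard_le_ncard (fun b (hb : ν b ≤ R) => hb.trans hRR)
            (hν.finite_ball R₀)
      _ ≤ max (V + 1) (({b | ν b ≤ R₀} : Set (𝓞 K)).ncard) * 1 := by
          rw [mul_one]; exact le_max_right _ _
      _ ≤ _ := by gcongr; exact one_le_pow₀ hR

theorem tendsto_ncard_ball (hν : IsEmbeddingNorm ν) :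
    Tendsto (fun R : ℝ => (({b | ν b ≤ R} : Set (𝓞 K)).ncard : ℝ)) atTop atTop := by
  obtain ⟨κ, hκ, h⟩ := hν.exists_le_ncard_ball
  refine tendsto_atTop_mono' _ ?_
    ((tendsto_pow_atTop (Module.finrank_pos (R := ℚ) (M := K)).ne').const_mul_atTop hκ)
  filter_upwards [eventually_ge_atTop 0] with R hR using h R hR

end IsEmbeddingNorm

/-! ### Densities of unions of residue classes -/

/-- The proportion of the integers `b` with `ν b ≤ R` that lie in `X`. -/
def proportion (ν : AddGroupSeminorm (𝓞 K)) (X : Set (𝓞 K)) (R : ℝ) : ℝ :=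
  ((X ∩ {b | ν b ≤ R}).ncard : ℝ) / ({b | ν b ≤ R} : Set (𝓞 K)).ncard

theorem proportion_nonneg (X : Set (𝓞 K)) (R : ℝ) : 0 ≤ proportion ν X R := by
  unfold proportion; positivity

theorem proportion_mono (hν : IsEmbeddingNorm ν) {X Y : Set (𝓞 K)} (h : X ⊆ Y) (R : ℝ) :
    proportion ν X R ≤ proportion ν Y R := by
  unfold proportion
  gcongr
  exact (hν.finite_ball R).inter_of_right Y

theorem proportion_union_le (X Y : Set (𝓞 K)) (R : ℝ) :
    proportion ν (X ∪ Y) R ≤ proportion ν X R + proportion ν Y R := by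
  unfold proportion
  rw [← add_div, Set.union_inter_distrib_right]
  gcongr
  exact_mod_cast Set.ncard_union_le _ _

theorem proportion_union (hν : IsEmbeddingNorm ν) {X Y : Set (𝓞 K)} (h : Disjoint X Y) (R : ℝ) :
    proportion ν (X ∪ Y) R = proportion ν X R + proportion ν Y R := by
  unfold proportion
  rw [← add_div, Set.union_inter_distrib_right, Set.ncard_union_eq
    (h.mono Set.inter_subset_left Set.inter_subset_left)
    ((hν.finite_ball R).inter_of_right X) ((hν.finite_ball R).inter_of_right Y)]
  push_cast
  rfl

theorem proportion_empty (R : ℝ) : proportion ν ∅ R = 0 := by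
  simp [proportion]

theorem proportion_biUnion_le {ι : Type*} (s : Finset ι) (X : ι → Set (𝓞 K)) (R : ℝ) :
    proportion ν (⋃ i ∈ s, X i) R ≤ ∑ i ∈ s, proportion ν (X i) R := by
  classical
  induction s using Finset.induction_on with
  | empty => simp [proportion_empty]
  | insert i s hi ih =>
    rw [Finset.sum_insert hi, Finset.set_biUnion_insert]
    exact (proportion_union_le _ _ _).trans (by gcongr)

/-- A finite set has density zero. -/
theorem tendsto_proportion_of_finite (hν : IsEmbeddingNorm ν) {X : Set (𝓞 K)} (hX : X.Finite) :
    Tendsto (proportion ν X) atTop (𝓝 0) := by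
  refine squeeze_zero (proportion_nonneg X) (fun R => ?_)
    ((tendsto_const_nhds (x := (X.ncard : ℝ))).div_atTop hν.tendsto_ncard_ball)
  unfold proportion
  gcongr
  exact Set.inter_subset_left

/-- The residue classes modulo a nonzero ideal are equidistributed. -/
theorem tendsto_proportion_residue (hν : IsEmbeddingNorm ν) {I : Ideal (𝓞 K)} (hI : I ≠ ⊥)
    (r : 𝓞 K ⧸ I) :
    Tendsto (proportion ν (Ideal.Quotient.mk I ⁻¹' {r})) atTop (𝓝 (1 / Ideal.absNorm I)) := by
  have : Finite (𝓞 K ⧸ I) := Ideal.finiteQuotientOfFreeOfNeBot I hI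
  have := Fintype.ofFinite (𝓞 K ⧸ I)
  have hcard : (Ideal.absNorm I : ℝ) = Fintype.card (𝓞 K ⧸ I) := by
    rw [Ideal.absNorm_apply, Submodule.cardQuot_apply, Nat.card_eq_fintype_card]
  have hN : (0 : ℝ) < Ideal.absNorm I := by
    rw [hcard]; exact_mod_cast Fintype.card_pos
  choose rep hrep using Ideal.Quotient.mk_surjective (I := I)
  obtain ⟨C, hC⟩ : ∃ C, ∀ s t : 𝓞 K ⧸ I, ν (rep s - rep t) ≤ C := by
    obtain ⟨C, hC⟩ := (Set.finite_range
      (fun st : (𝓞 K ⧸ I) × (𝓞 K ⧸ I) => ν (rep st.1 - rep st.2))).bddAbove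
    exact ⟨C, fun s t => hC ⟨(s, t), rfl⟩⟩
  set F : (𝓞 K ⧸ I) → ℝ → Set (𝓞 K) := fun s R => Ideal.Quotient.mk I ⁻¹' {s} ∩ {b | ν b ≤ R}
  have hfin : ∀ s R, (F s R).Finite := fun s R => (hν.finite_ball R).inter_of_right _
  -- Translation by `rep t - rep s` carries class `s` into class `t` and raises `ν` by at most `C`.
  -- All classes thus have nearly equal counts, and these sum to the ball.
  have hshift : ∀ s t R, (F s R).ncard ≤ (F t (R + C)).ncard := fun s t R => by
    refine Set.ncard_le_ncard_of_injOn (fun b => b + (rep t - rep s)) ?_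
      (add_left_injective _).injOn (hfin t _)
    rintro b ⟨hb, hbR⟩
    refine ⟨?_, ?_⟩
    · simp only [Set.mem_preimage, Set.mem_singleton_iff] at hb ⊢
      simp [hb, hrep]
    · exact (map_add_le_add ν _ _).trans (add_le_add hbR (hC t s))
  have hsum : ∀ R, ∑ s, (F s R).ncard = ({b | ν b ≤ R} : Set (𝓞 K)).ncard := fun R => by
    rw [← finsum_eq_sum_of_fintype, ← Set.ncard_iUnion_of_finite (fun s => hfin s R)]
    · congr 1
      ext b
      simp [F]
    · intro s t hst
      refine Set.disjoint_left.2 fun b hb hb' => hst ?_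
      exact hb.1.symm.trans hb'.1
  have hup : ∀ R, (Ideal.absNorm I : ℝ) * (F r R).ncard ≤
      ({b | ν b ≤ R + C} : Set (𝓞 K)).ncard := fun R => by
    rw [hcard, ← hsum]
    push_cast
    rw [← nsmul_eq_mul]
    exact Finset.card_nsmul_le_sum _ _ _ fun s _ => by exact_mod_cast hshift r s R
  have hlo : ∀ R, (({b | ν b ≤ R + -C} : Set (𝓞 K)).ncard : ℝ) ≤
      (Ideal.absNorm I : ℝ) * (F r R).ncard := fun R => by
    rw [hcard, ← hsum]
    push_cast
    rw [← nsmul_eq_mul]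
    refine Finset.sum_le_card_nsmul _ _ _ fun s _ => ?_
    have := hshift s r (R + -C)
    rw [neg_add_cancel_right] at this
    exact_mod_cast this
  refine tendsto_of_tendsto_of_tendsto_of_le_of_le
    ((hν.tendsto_ncard_ball_add (-C)).div_const (Ideal.absNorm I : ℝ))
    ((hν.tendsto_ncard_ball_add C).div_const (Ideal.absNorm I : ℝ)) (fun R => ?_) (fun R => ?_)
  · rw [div_right_comm]
    unfold proportion
    gcongr
    rw [div_le_iff₀' hN]
    exact hlo R
  · dsimp only
    rw [div_right_comm]
    unfold proportion
    gcongr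
    rw [le_div_iff₀' hN]
    exact hup R

/-- `X` is a union of residue classes modulo `I`, which make up the proportion `δ` of all residue
classes. -/
def HasResidueDensity (I : Ideal (𝓞 K)) (X : Set (𝓞 K)) (δ : ℝ) : Prop :=
  ∃ Y : Set (𝓞 K ⧸ I), X = Ideal.Quotient.mk I ⁻¹' Y ∧ δ = Y.ncard / Ideal.absNorm I

theorem HasResidueDensity.tendsto_proportion (hν : IsEmbeddingNorm ν) {I : Ideal (𝓞 K)}
    (hI : I ≠ ⊥) {X : Set (𝓞 K)} {δ : ℝ} (h : HasResidueDensity I X δ) :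
    Tendsto (proportion ν X) atTop (𝓝 δ) := by
  obtain ⟨Y, rfl, rfl⟩ := h
  have : Finite (𝓞 K ⧸ I) := Ideal.finiteQuotientOfFreeOfNeBot I hI
  induction Y, Set.toFinite Y using Set.Finite.induction_on with
  | empty => simpa using tendsto_proportion_of_finite hν Set.finite_empty
  | @insert r Y hr hY ih =>
    rw [Set.ncard_insert_of_notMem hr hY, Nat.cast_add, Nat.cast_one, add_comm, add_div]
    refine ((tendsto_proportion_residue hν hI r).add ih).congr fun R => ?_
    rw [Set.insert_eq, Set.preimage_union, proportion_union hν]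
    exact Disjoint.preimage _ (Set.disjoint_singleton_left.2 hr)

/-- Conditions modulo coprime ideals are independent. -/
theorem HasResidueDensity.inter {I J : Ideal (𝓞 K)} (hIJ : IsCoprime I J) {X X' : Set (𝓞 K)}
    {δ δ' : ℝ} (h : HasResidueDensity I X δ) (h' : HasResidueDensity J X' δ') :
    HasResidueDensity (I * J) (X ∩ X') (δ * δ') := by
  obtain ⟨Y, rfl, rfl⟩ := h
  obtain ⟨Y', rfl, rfl⟩ := h'
  set e := Ideal.quotientMulEquivQuotientProd I J hIJ
  refine ⟨e ⁻¹' (Y ×ˢ Y'), ?_, ?_⟩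
  · ext b
    simp only [Set.mem_inter_iff, Set.mem_preimage, Set.mem_prod]
    rw [Ideal.quotientMulEquivQuotientProd_fst, Ideal.quotientMulEquivQuotientProd_snd]
    simp
  · rw [Set.ncard_preimage_of_injective_subset_range e.injective
      (by rw [e.surjective.range_eq]; exact Set.subset_univ _), Set.ncard_prod, map_mul]
    push_cast
    rw [div_mul_div_comm]

theorem hasResidueDensity_compl {I : Ideal (𝓞 K)} (hI : I ≠ ⊥) {X : Set (𝓞 K)} {δ : ℝ}
    (h : HasResidueDensity I X δ) : HasResidueDensity I Xᶜ (1 - δ) := by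
  obtain ⟨Y, rfl, rfl⟩ := h
  have : Finite (𝓞 K ⧸ I) := Ideal.finiteQuotientOfFreeOfNeBot I hI
  have hN : (Ideal.absNorm I : ℝ) ≠ 0 := by
    simpa [Ideal.absNorm_eq_zero_iff] using hI
  refine ⟨Yᶜ, rfl, ?_⟩
  have h1 := Set.ncard_add_ncard_compl Y
  have h2 : Nat.card (𝓞 K ⧸ I) = Ideal.absNorm I := by
    rw [Ideal.absNorm_apply, Submodule.cardQuot_apply]
  rw [h2] at h1
  rw [eq_div_iff hN, sub_mul, one_mul, div_mul_cancel₀ _ hN, ← h1]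
  push_cast
  ring

/-- A nonempty set defined by congruences at `S` has a positive density. -/
theorem DefinedByCongruencesAt.exists_hasResidueDensity {S : Finset (HeightOneSpectrum (𝓞 K))}
    {T : Set (𝓞 K)} (hT : DefinedByCongruencesAt S T) (hTne : T.Nonempty) :
    ∃ (e : HeightOneSpectrum (𝓞 K) → ℕ) (δ : ℝ), 0 < δ ∧
      HasResidueDensity (∏ p ∈ S, p.asIdeal ^ e p) T δ := by
  obtain ⟨e, he⟩ := hT
  set I : Ideal (𝓞 K) := ∏ p ∈ S, p.asIdeal ^ e p with hIdef
  have hI : I ≠ ⊥ := Finset.prod_ne_zero_iff.2 fun p _ => pow_ne_zero _ p.ne_bot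
  have : Finite (𝓞 K ⧸ I) := Ideal.finiteQuotientOfFreeOfNeBot I hI
  have hN : 0 < Ideal.absNorm I :=
    Nat.pos_of_ne_zero (by simpa [Ideal.absNorm_eq_zero_iff] using hI)
  refine ⟨e, (Ideal.Quotient.mk I '' T).ncard / Ideal.absNorm I, ?_, Ideal.Quotient.mk I '' T, ?_,
    rfl⟩
  · have : 0 < (Ideal.Quotient.mk I '' T).ncard := (Set.ncard_pos).2 (hTne.image _)
    positivity
  · refine (Set.subset_preimage_image _ _).antisymm ?_
    rintro b ⟨b', hb', h⟩
    refine (he b' b fun p hp => ?_).1 hb'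
    have h1 := Ideal.Quotient.eq.1 h
    exact Ideal.le_of_dvd (Finset.dvd_prod_of_mem (fun p => p.asIdeal ^ e p) hp) h1

theorem hasResidueDensity_localDensity (A : (𝓞 K)[X]) (p : HeightOneSpectrum (𝓞 K)) :
    HasResidueDensity (p.asIdeal ^ 2) {b | A.eval b ∉ p.asIdeal ^ 2} (localDensity A p) := by
  refine ⟨{b | (A.map (Ideal.Quotient.mk (p.asIdeal ^ 2))).eval b ≠ 0}, ?_, ?_⟩
  · ext b
    simp only [Set.mem_ofPred_eq, Set.mem_preimage, Polynomial.eval_map_apply, ne_eq,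
      Ideal.Quotient.eq_zero_iff_mem]
  · rw [localDensity, Ideal.absNorm_apply, Submodule.cardQuot_apply, ← Nat.card_coe_set_eq]
    rfl

/-- The density of the elements of `T` that satisfy finitely many of the local conditions. -/
theorem exists_tendsto_proportion_inter (hν : IsEmbeddingNorm ν)
    {S : Finset (HeightOneSpectrum (𝓞 K))} {T : Set (𝓞 K)} (hT : DefinedByCongruencesAt S T)
    (hTne : T.Nonempty) (A : (𝓞 K)[X]) :
    ∃ δ : ℝ, 0 < δ ∧ ∀ P : Finset (HeightOneSpectrum (𝓞 K)), Disjoint P S →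
      Tendsto (proportion ν {b | b ∈ T ∧ ∀ p ∈ P, A.eval b ∉ p.asIdeal ^ 2}) atTop
        (𝓝 (δ * ∏ p ∈ P, localDensity A p)) := by
  classical
  obtain ⟨e, δ, hδ, h⟩ := hT.exists_hasResidueDensity hTne
  refine ⟨δ, hδ, fun P hP => ?_⟩
  have hcop : ∀ p p' : HeightOneSpectrum (𝓞 K), p ≠ p' → IsCoprime p.asIdeal p'.asIdeal :=
    fun p p' hpp => by
      have := p.isMaximal
      have := p'.isMaximal
      exact Ideal.isCoprime_of_isMaximal fun h => hpp (HeightOneSpectrum.ext h)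
  have key : HasResidueDensity ((∏ p ∈ S, p.asIdeal ^ e p) * ∏ p ∈ P, p.asIdeal ^ 2)
      {b | b ∈ T ∧ ∀ p ∈ P, A.eval b ∉ p.asIdeal ^ 2} (δ * ∏ p ∈ P, localDensity A p) := by
    induction P using Finset.induction_on with
    | empty => simpa using h
    | insert p P hp ih =>
      rw [Finset.disjoint_insert_left] at hP
      rw [Finset.prod_insert hp, Finset.prod_insert hp]
      have h1 := (ih hP.2).inter ?_ (hasResidueDensity_localDensity A p)
      · convert h1 using 1
        · ring
        · ext b
          simp only [Finset.mem_insert, Set.mem_ofPred_eq, Set.mem_inter_iff, forall_eq_or_imp]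
          tauto
        · ring
      · refine IsCoprime.mul_left (IsCoprime.prod_left fun p' hp' => ?_)
          (IsCoprime.prod_left fun p' hp' => ?_)
        · exact (hcop p' p (fun h => hP.1 (h ▸ hp'))).pow
        · exact (hcop p' p (fun h => hp (h ▸ hp'))).pow
  refine key.tendsto_proportion hν (mul_ne_zero ?_ ?_)
  · exact Finset.prod_ne_zero_iff.2 fun p _ => pow_ne_zero _ p.ne_bot
  · exact Finset.prod_ne_zero_iff.2 fun p _ => pow_ne_zero _ p.ne_bot

/-! ### Values of one linear form in an ideal -/

/-- The norm is the product of the absolute values of the `n` conjugates. -/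
theorem absNorm_span_le_pow {x : 𝓞 K} {r : ℝ} (h : ∀ σ : K →+* ℂ, ‖σ (x : K)‖ ≤ r) :
    (Ideal.absNorm (Ideal.span {x}) : ℝ) ≤ r ^ Module.finrank ℚ K := by
  have h1 : (Ideal.absNorm (Ideal.span {x}) : ℝ) =
      ∏ w : InfinitePlace K, w (x : K) ^ w.mult := by
    rw [InfinitePlace.prod_eq_abs_norm, Ideal.absNorm_span_singleton, ← Algebra.coe_norm_int]
    simp [Nat.cast_natAbs]
  rw [h1, ← InfinitePlace.sum_mult_eq, ← Finset.prod_pow_eq_pow_sum]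
  refine Finset.prod_le_prod (fun w _ => by positivity) fun w _ => ?_
  gcongr
  rw [← InfinitePlace.norm_embedding_eq]
  exact h _

/-- A multiple of an ideal has at least the norm of the ideal. -/
theorem absNorm_le_absNorm_span {J : Ideal (𝓞 K)} {x : 𝓞 K} (hx : x ∈ J) (hx0 : x ≠ 0) :
    Ideal.absNorm J ≤ Ideal.absNorm (Ideal.span {x}) := by
  refine Nat.le_of_dvd ?_ (Ideal.absNorm_dvd_absNorm_of_le
    ((Ideal.span_singleton_le_iff_mem J).2 hx))
  rw [Nat.pos_iff_ne_zero, Ne, Ideal.absNorm_eq_zero_iff]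
  simpa using hx0

/-- The number of `b` in a ball with `c * b + d` a nonzero element of `J` is at most a constant times
the number of points in the ball over the norm of `J`, uniformly in `J`. -/
theorem exists_proportion_linear_le (hν : IsEmbeddingNorm ν) {c : 𝓞 K} (hc : c ≠ 0) (d : 𝓞 K) :
    ∃ C : ℝ, 0 ≤ C ∧ ∀ J : Ideal (𝓞 K), J ≠ ⊥ → ∀ R : ℝ, 1 ≤ R →
      proportion ν {b | c * b + d ∈ J ∧ c * b + d ≠ 0} R ≤ C * (Ideal.absNorm J : ℝ)⁻¹ := by
  obtain ⟨κ, hκ, hlow⟩ := hν.exists_le_ncard_ball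
  obtain ⟨κ', hκ', hup⟩ := hν.exists_ncard_ball_le
  set n := Module.finrank ℚ K with hn
  have hn0 : n ≠ 0 := (Module.finrank_pos (R := ℚ) (M := K)).ne'
  set Nc : ℝ := (Ideal.absNorm (Ideal.span {c}) : ℝ) with hNc
  have hNc1 : 1 ≤ Nc := by
    have : Ideal.absNorm (Ideal.span {c}) ≠ 0 := by simpa [Ideal.absNorm_eq_zero_iff] using hc
    rw [hNc]
    exact_mod_cast Nat.one_le_iff_ne_zero.2 this
  set M : ℝ := ν c + ν d with hM
  have hM0 : 0 ≤ M := add_nonneg (apply_nonneg ν c) (apply_nonneg ν d)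
  refine ⟨κ' * (1 + M) ^ n * (3 ^ n * Nc) / (κ * κ), by positivity, fun J hJ R hR => ?_⟩
  have hR0 : 0 < R := one_pos.trans_le hR
  set D : Set (𝓞 K) := {b | c * b + d ∈ J ∧ c * b + d ≠ 0} ∩ {b | ν b ≤ R} with hD
  have hNJ : (0 : ℝ) < Ideal.absNorm J := by
    have : Ideal.absNorm J ≠ 0 := by simpa [Ideal.absNorm_eq_zero_iff] using hJ
    exact_mod_cast Nat.pos_of_ne_zero this
  -- The separation: a nonzero `x` with `c * x ∈ J` has `N(J) ≤ Nc * ν x ^ n`, that is `θ ≤ ν x`.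
  -- With radius `θ / 3`, balls about distinct points of `D` are disjoint.
  set θ : ℝ := ((Ideal.absNorm J : ℝ) / Nc) ^ (1 / (n : ℝ)) with hθ
  have hθ0 : 0 < θ := Real.rpow_pos_of_pos (by positivity) _
  have hθn : θ ^ n = (Ideal.absNorm J : ℝ) / Nc := by
    rw [hθ, one_div, Real.rpow_inv_natCast_pow (by positivity) hn0]
  set ρ : ℝ := θ / 3 with hρ
  have hρ0 : 0 < ρ := by positivity
  rcases D.eq_empty_or_nonempty with hDe | ⟨b₀, ⟨hb₀J, hb₀0⟩, hb₀R⟩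
  · rw [proportion, ← hD, hDe]
    simp only [Set.ncard_empty, Nat.cast_zero, zero_div]
    positivity
  -- A single nonzero value in `J` already bounds `N(J)` by `(M * R) ^ n`. Hence `ρ` is `O(R)`, and
  -- the enlarged ball of radius `R + ρ` still has `O(R ^ n)` points.
  have hθM : θ ≤ M * R := by
    refine le_of_pow_le_pow_left₀ hn0 (by positivity) ?_
    calc θ ^ n ≤ Ideal.absNorm J := by
          rw [hθn]
          exact div_le_self hNJ.le hNc1
      _ ≤ Ideal.absNorm (Ideal.span {c * b₀ + d}) := by
          exact_mod_cast absNorm_le_absNorm_span hb₀J hb₀0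
      _ ≤ (M * R) ^ n := absNorm_span_le_pow fun σ => ?_
    calc ‖σ ((c * b₀ + d : 𝓞 K) : K)‖ ≤ ‖σ (c : K)‖ * ‖σ (b₀ : K)‖ + ‖σ (d : K)‖ := by
          push_cast
          rw [map_add, map_mul, ← norm_mul]
          exact norm_add_le _ _
      _ ≤ ν c * R + ν d * R := by
          refine add_le_add (mul_le_mul (hν.norm_le σ c) ((hν.norm_le σ b₀).trans hb₀R)
            (norm_nonneg _) (apply_nonneg ν c)) ((hν.norm_le σ d).trans ?_)
          exact le_mul_of_one_le_right (apply_nonneg ν d) hR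
      _ = M * R := by rw [hM, add_mul]
  -- The translates of the `ρ`-ball by points of `D` are disjoint and lie in the ball of radius `R +
  -- ρ`.
  have hpack : D.ncard * ({b | ν b ≤ ρ} : Set (𝓞 K)).ncard ≤
      ({b | ν b ≤ R + ρ} : Set (𝓞 K)).ncard := by
    rw [← Set.ncard_prod]
    refine Set.ncard_le_ncard_of_injOn (fun x => x.1 + x.2) ?_ ?_ (hν.finite_ball _)
    · rintro ⟨b, x⟩ ⟨hb, hx⟩
      exact (map_add_le_add ν _ _).trans (add_le_add hb.2 hx)
    · rintro ⟨b, x⟩ ⟨hb, hx⟩ ⟨b', x'⟩ ⟨hb', hx'⟩ h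
      simp only at h hb hx hb' hx'
      have hbb : b - b' = x' - x := by linear_combination h
      have hβ : ν (b - b') ≤ 2 * ρ := by
        rw [hbb]
        refine (map_sub_le_add ν _ _).trans ?_
        rw [two_mul]
        exact add_le_add hx' hx
      have hmem : c * (b - b') ∈ J := by
        have := J.sub_mem hb.1.1 hb'.1.1
        convert this using 1
        ring
      have hzero : b - b' = 0 := by
        by_contra hne
        have h1 : (Ideal.absNorm J : ℝ) ≤ Nc * (2 * ρ) ^ n := by
          calc (Ideal.absNorm J : ℝ) ≤ Ideal.absNorm (Ideal.span {c * (b - b')}) := by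
                exact_mod_cast absNorm_le_absNorm_span hmem (mul_ne_zero hc hne)
            _ = Nc * Ideal.absNorm (Ideal.span {b - b'}) := by
                rw [← Ideal.span_singleton_mul_span_singleton, map_mul]
                push_cast
                rfl
            _ ≤ Nc * ν (b - b') ^ n := by
                gcongr
                exact absNorm_span_le_pow fun σ => hν.norm_le σ _
            _ ≤ _ := by gcongr
        have h2 : Nc * (2 * ρ) ^ n < Nc * θ ^ n := by
          have : 2 * ρ < θ := by rw [hρ]; linarith
          gcongr
        rw [hθn, mul_div_cancel₀ _ (by positivity)] at h2
        linarith
      have hb_eq := sub_eq_zero.1 hzero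
      rw [hzero] at hbb
      exact Prod.ext hb_eq (sub_eq_zero.1 hbb.symm).symm
  have hfinal : (D.ncard : ℝ) * (κ * ρ ^ n) ≤ κ' * ((1 + M) * R) ^ n := by
    calc (D.ncard : ℝ) * (κ * ρ ^ n)
        ≤ D.ncard * ({b | ν b ≤ ρ} : Set (𝓞 K)).ncard := by
          gcongr
          exact hlow ρ hρ0.le
      _ ≤ ({b | ν b ≤ R + ρ} : Set (𝓞 K)).ncard := by exact_mod_cast hpack
      _ ≤ κ' * (R + ρ) ^ n := hup _ (by linarith)
      _ ≤ _ := by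
          gcongr
          rw [hρ]
          nlinarith
  have hρn : ρ ^ n = (Ideal.absNorm J : ℝ) / (3 ^ n * Nc) := by
    rw [hρ, div_pow, hθn, div_div, mul_comm Nc]
  rw [proportion, ← hD, div_le_iff₀ (by exact_mod_cast hν.ncard_ball_pos hR0.le)]
  refine le_trans ?_ (mul_le_mul_of_nonneg_left (hlow R hR0.le) (by positivity))
  rw [hρn, mul_pow] at hfinal
  rw [← div_eq_mul_inv, div_mul_eq_mul_div, le_div_iff₀ hNJ]
  have h3 : (0 : ℝ) < 3 ^ n * Nc := by positivity
  have h4 : (D.ncard : ℝ) * Ideal.absNorm J * κ ≤ κ' * ((1 + M) ^ n * R ^ n) * (3 ^ n * Nc) := by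
    rw [← div_le_iff₀ h3]
    refine le_trans (le_of_eq ?_) hfinal
    ring
  rw [← le_div_iff₀ hκ] at h4
  refine h4.trans (le_of_eq ?_)
  field_simp

/-! ### Coprimality of the linear forms outside finitely many primes -/

section Algebra

variable {k : ℕ} {c d : Fin k → 𝓞 K}

theorem eval_prodLinear (c d : Fin k → 𝓞 K) (b : 𝓞 K) :
    (prodLinear c d).eval b = ∏ i, (c i * b + d i) := by
  simp [prodLinear, eval_prod]

theorem map_prodLinear (c d : Fin k → 𝓞 K) :
    (prodLinear c d).map (algebraMap (𝓞 K) K) =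
      ∏ i, (C (c i : K) * X + C (d i : K)) := by
  simp [prodLinear, Polynomial.map_prod]

/-- A zero factor would make the product zero, which is not squarefree. -/
theorem constant_ne_zero
    (hA : Squarefree ((prodLinear c d).map (algebraMap (𝓞 K) K))) {i : Fin k} (hi : c i = 0) :
    d i ≠ 0 := by
  intro hdi
  refine hA.ne_zero ?_
  rw [map_prodLinear]
  exact Finset.prod_eq_zero (Finset.mem_univ i) (by simp [hi, hdi])

/-- A vanishing determinant makes the two forms proportional, and then the product is divisible by
the square of a nonconstant form. -/
theorem resultant_ne_zero
    (hA : Squarefree ((prodLinear c d).map (algebraMap (𝓞 K) K))) {i j : Fin k} (hij : i ≠ j)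
    (hi : c i ≠ 0) (hj : c j ≠ 0) : c i * d j - c j * d i ≠ 0 := by
  intro h
  have hi' : (c i : K) ≠ 0 := by exact_mod_cast hi
  have hj' : (c j : K) ≠ 0 := by exact_mod_cast hj
  have h' : (c i : K) * d j = c j * d i := by exact_mod_cast sub_eq_zero.1 h
  set L : Fin k → K[X] := fun i => C (c i : K) * X + C (d i : K) with hL
  have hLij : L i = C ((c i : K) / c j) * L j := by
    simp only [hL, mul_add, ← mul_assoc, ← C_mul]
    rw [div_mul_cancel₀ _ hj', div_mul_eq_mul_div, h', mul_div_cancel_left₀ _ hj']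
  have hdvd : L j * L j ∣ (prodLinear c d).map (algebraMap (𝓞 K) K) := by
    rw [map_prodLinear]
    calc L j * L j ∣ ∏ l ∈ {i, j}, L l := by
          rw [Finset.prod_pair hij, hLij, mul_assoc]
          exact dvd_mul_left _ _
      _ ∣ _ := Finset.prod_dvd_prod_of_subset _ _ _ (Finset.subset_univ _)
  have hdeg := degree_eq_zero_of_isUnit (hA _ hdvd)
  rw [hL, degree_linear hj'] at hdeg
  exact one_ne_zero hdeg

theorem finite_setOf_mem_asIdeal {z : 𝓞 K} (hz : z ≠ 0) :
    {p : HeightOneSpectrum (𝓞 K) | z ∈ p.asIdeal}.Finite := by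
  refine (Ideal.finite_factors (I := Ideal.span {z}) (by simpa using hz)).subset fun p hp => ?_
  exact Ideal.dvd_iff_le.2 ((Ideal.span_singleton_le_iff_mem _).2 hp)

/-- Outside a finite set of primes, `p ^ 2` divides the product of the linear forms only if it
divides one of the nonconstant ones. -/
theorem exists_finset_forall_eval_mem
    (hA : Squarefree ((prodLinear c d).map (algebraMap (𝓞 K) K))) :
    ∃ B : Finset (HeightOneSpectrum (𝓞 K)), ∀ p ∉ B, ∀ b : 𝓞 K,
      (prodLinear c d).eval b ∈ p.asIdeal ^ 2 →
        ∃ i, c i ≠ 0 ∧ c i * b + d i ∈ p.asIdeal ^ 2 := by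
  -- The excluded primes contain a constant factor or the determinant of two nonconstant forms.
  have hfin : ((⋃ i ∈ {i | c i = 0}, {p : HeightOneSpectrum (𝓞 K) | d i ∈ p.asIdeal}) ∪
      ⋃ ij ∈ {ij : Fin k × Fin k | ij.1 ≠ ij.2 ∧ c ij.1 ≠ 0 ∧ c ij.2 ≠ 0},
        {p : HeightOneSpectrum (𝓞 K) | c ij.1 * d ij.2 - c ij.2 * d ij.1 ∈ p.asIdeal}).Finite :=
    ((Set.toFinite _).biUnion fun i hi => finite_setOf_mem_asIdeal (constant_ne_zero hA hi)).union
      ((Set.toFinite _).biUnion fun ij h =>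
        finite_setOf_mem_asIdeal (resultant_ne_zero hA h.1 h.2.1 h.2.2))
  refine ⟨hfin.toFinset, fun p hp b hb => ?_⟩
  rw [Set.Finite.mem_toFinset] at hp
  simp only [Set.mem_union, Set.mem_iUnion, Set.mem_ofPred_eq, not_or, not_exists] at hp
  obtain ⟨hp1, hp2⟩ := hp
  have hprime := p.isPrime
  rw [eval_prodLinear] at hb
  have hb1 : ∏ i, (c i * b + d i) ∈ p.asIdeal := Ideal.pow_le_self two_ne_zero hb
  obtain ⟨i, -, hi⟩ := (hprime.prod_mem_iff).1 hb1
  have hconst : ∀ l, c l * b + d l ∈ p.asIdeal → c l ≠ 0 := fun l hl h0 => by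
    refine hp1 l h0 ?_
    simpa [h0] using hl
  refine ⟨i, hconst i hi, ?_⟩
  -- Two factors in `p` would put their determinant in `p`. So `p` contains only the factor `i`,
  -- which must carry all of `p ^ 2`.
  have hrest : ∏ l ∈ Finset.univ.erase i, (c l * b + d l) ∉ p.asIdeal := by
    rw [hprime.prod_mem_iff]
    rintro ⟨l, hl, hmem⟩
    refine hp2 (i, l) ⟨(Finset.ne_of_mem_erase hl).symm, hconst i hi, hconst l hmem⟩ ?_
    have := p.asIdeal.sub_mem (p.asIdeal.mul_mem_left (c i) hmem)
      (p.asIdeal.mul_mem_left (c l) hi)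
    convert this using 1
    ring
  rw [← Finset.mul_prod_erase _ _ (Finset.mem_univ i)] at hb
  exact (Ideal.IsPrime.mem_pow_mul _ hb).resolve_right hrest

end Algebra

theorem squarefreeAway_iff (S : Finset (HeightOneSpectrum (𝓞 K))) (a : 𝓞 K) :
    SquarefreeAway S a ↔ ∀ p : HeightOneSpectrum (𝓞 K), p ∉ S → a ∉ p.asIdeal ^ 2 := by
  simp [SquarefreeAway, Ideal.dvd_iff_le]

/-! ### The sieve: tail estimate, convergence of the product, density -/

section Sieve

variable {k : ℕ} {c d : Fin k → 𝓞 K}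

/-- The integers at which `p ^ 2` divides the product, for some `p` in a set `Q` of primes with small
`∑ N(p)⁻²`, are rare. -/
theorem exists_proportion_le_of_sum_le (hν : IsEmbeddingNorm ν)
    (hA : Squarefree ((prodLinear c d).map (algebraMap (𝓞 K) K))) :
    ∃ (B : Finset (HeightOneSpectrum (𝓞 K))) (C : ℝ) (E : ℝ → ℝ), 0 ≤ C ∧
      Tendsto E atTop (𝓝 0) ∧ ∀ (Q : Set (HeightOneSpectrum (𝓞 K))) (ε : ℝ),
        (∀ p ∈ Q, p ∉ B) →
        (∀ F : Finset (HeightOneSpectrum (𝓞 K)), ↑F ⊆ Q →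
          ∑ p ∈ F, ((Ideal.absNorm p.asIdeal : ℝ) ^ 2)⁻¹ ≤ ε) →
        ∀ R : ℝ, 1 ≤ R →
          proportion ν {b | ∃ p ∈ Q, (prodLinear c d).eval b ∈ p.asIdeal ^ 2} R ≤ C * ε + E R := by
  classical
  obtain ⟨B, hB⟩ := exists_finset_forall_eval_mem hA
  have hC : ∀ i, ∃ C : ℝ, 0 ≤ C ∧ (c i ≠ 0 → ∀ J : Ideal (𝓞 K), J ≠ ⊥ → ∀ R : ℝ, 1 ≤ R →
      proportion ν {b | c i * b + d i ∈ J ∧ c i * b + d i ≠ 0} R ≤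
        C * (Ideal.absNorm J : ℝ)⁻¹) := fun i => by
    by_cases hi : c i = 0
    · exact ⟨0, le_rfl, fun h => absurd hi h⟩
    · obtain ⟨C, hC0, hC⟩ := exists_proportion_linear_le hν hi (d i)
      exact ⟨C, hC0, fun _ => hC⟩
  choose C hC0 hC using hC
  -- Zeros of the forms lie in every `p ^ 2` and escape the linear estimate; being finite in number,
  -- they only contribute the error `E`.
  set Z : Set (𝓞 K) := ⋃ i ∈ {i | c i ≠ 0}, {b | c i * b + d i = 0} with hZ
  have hZfin : Z.Finite := by
    refine (Set.toFinite _).biUnion fun i (hi : c i ≠ 0) => Set.Subsingleton.finite ?_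
    intro b hb b' hb'
    exact mul_left_cancel₀ hi (add_right_cancel (hb.trans hb'.symm))
  refine ⟨B, ∑ i, C i, proportion ν Z, Finset.sum_nonneg fun i _ => hC0 i,
    tendsto_proportion_of_finite hν hZfin, fun Q ε hQ hε R hR => ?_⟩
  set W : Set (𝓞 K) := {b | ∃ p ∈ Q, (prodLinear c d).eval b ∈ p.asIdeal ^ 2} with hW
  have hWfin : (W ∩ {b | ν b ≤ R}).Finite := (hν.finite_ball R).inter_of_right _
  -- `Q` may be infinite, but the ball is finite: one prime chosen for each bad `b` gives a finite
  -- set `F`, and finite subadditivity suffices.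
  choose pr hprQ hpr using fun b : ↥(W ∩ {b | ν b ≤ R}) => b.2.1
  have := hWfin.fintype
  set F : Finset (HeightOneSpectrum (𝓞 K)) := Finset.univ.image pr with hF
  have hFQ : ↑F ⊆ Q := by
    intro p hp
    obtain ⟨b, -, rfl⟩ := Finset.mem_image.1 (Finset.mem_coe.1 hp)
    exact hprQ b
  set Y : Fin k → HeightOneSpectrum (𝓞 K) → Set (𝓞 K) := fun i p =>
    if c i = 0 then ∅ else {b | c i * b + d i ∈ p.asIdeal ^ 2 ∧ c i * b + d i ≠ 0} with hY
  have hYle : ∀ i p, proportion ν (Y i p) R ≤ C i * ((Ideal.absNorm p.asIdeal : ℝ) ^ 2)⁻¹ := by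
    intro i p
    by_cases hi : c i = 0
    · simp only [hY, if_pos hi, proportion_empty]
      have := hC0 i
      positivity
    · simp only [hY, if_neg hi]
      have := hC i hi (p.asIdeal ^ 2) (pow_ne_zero _ p.ne_bot) R hR
      simpa only [map_pow, Nat.cast_pow] using this
  have hcover : W ∩ {b | ν b ≤ R} ⊆ (⋃ i ∈ Finset.univ, ⋃ p ∈ F, Y i p) ∪ Z := by
    intro b hb
    obtain ⟨i, hi, hmem⟩ := hB (pr ⟨b, hb⟩) (hQ _ (hprQ ⟨b, hb⟩)) b (hpr ⟨b, hb⟩)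
    by_cases h0 : c i * b + d i = 0
    · exact Or.inr (Set.mem_biUnion (x := i) hi h0)
    · refine Or.inl (Set.mem_biUnion (x := i) (Finset.mem_univ i) (Set.mem_biUnion
        (x := pr ⟨b, hb⟩) (Finset.mem_image_of_mem _ (Finset.mem_univ _)) ?_))
      simp only [hY, if_neg hi]
      exact ⟨hmem, h0⟩
  calc proportion ν W R = proportion ν (W ∩ {b | ν b ≤ R}) R := by
        simp only [proportion, Set.inter_assoc, Set.inter_self]
    _ ≤ proportion ν ((⋃ i ∈ Finset.univ, ⋃ p ∈ F, Y i p) ∪ Z) R := proportion_mono hν hcover R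
    _ ≤ proportion ν (⋃ i ∈ Finset.univ, ⋃ p ∈ F, Y i p) R + proportion ν Z R :=
        proportion_union_le _ _ _
    _ ≤ ∑ i, ∑ p ∈ F, C i * ((Ideal.absNorm p.asIdeal : ℝ) ^ 2)⁻¹ + proportion ν Z R := by
        gcongr
        refine (proportion_biUnion_le _ _ _).trans (Finset.sum_le_sum fun i _ => ?_)
        exact (proportion_biUnion_le _ _ _).trans (Finset.sum_le_sum fun p _ => hYle i p)
    _ = (∑ i, C i) * ∑ p ∈ F, ((Ideal.absNorm p.asIdeal : ℝ) ^ 2)⁻¹ + proportion ν Z R := by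
        rw [Finset.sum_mul_sum]
    _ ≤ (∑ i, C i) * ε + proportion ν Z R := by
        have := Finset.sum_nonneg fun i (_ : i ∈ Finset.univ) => hC0 i
        gcongr
        exact hε F hFQ

theorem localDensity_nonneg (A : (𝓞 K)[X]) (p : HeightOneSpectrum (𝓞 K)) :
    0 ≤ localDensity A p := by
  unfold localDensity; positivity

theorem localDensity_le_one (A : (𝓞 K)[X]) (p : HeightOneSpectrum (𝓞 K)) :
    localDensity A p ≤ 1 := by
  have : Finite (𝓞 K ⧸ p.asIdeal ^ 2) :=
    Ideal.finiteQuotientOfFreeOfNeBot _ (pow_ne_zero _ p.ne_bot)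
  refine div_le_one_of_le₀ ?_ (Nat.cast_nonneg _)
  exact_mod_cast Finite.card_subtype_le _

/-- The local densities tend to `1` fast enough for their product to converge. -/
theorem summable_norm_localDensity_sub_one (hν : IsEmbeddingNorm ν)
    (hA : Squarefree ((prodLinear c d).map (algebraMap (𝓞 K) K))) :
    Summable (fun p : HeightOneSpectrum (𝓞 K) => ‖localDensity (prodLinear c d) p - 1‖) := by
  obtain ⟨B, C, E, hC, hE, h⟩ := exists_proportion_le_of_sum_le hν hA
  refine Summable.of_norm_bounded_eventually
    ((summable_absNorm_inv_sq (K := K)).mul_left C) ?_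
  filter_upwards [B.finite_toSet.compl_mem_cofinite] with p hp
  rw [norm_norm, Real.norm_eq_abs, abs_sub_comm,
    abs_of_nonneg (sub_nonneg.2 (localDensity_le_one _ p))]
  have hI : p.asIdeal ^ 2 ≠ ⊥ := pow_ne_zero _ p.ne_bot
  have h1 := (hasResidueDensity_compl hI
    (hasResidueDensity_localDensity (prodLinear c d) p)).tendsto_proportion hν hI
  have h2 : Tendsto (fun R => C * ((Ideal.absNorm p.asIdeal : ℝ) ^ 2)⁻¹ + E R) atTop
      (𝓝 (C * ((Ideal.absNorm p.asIdeal : ℝ) ^ 2)⁻¹ + 0)) := tendsto_const_nhds.add hE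
  rw [add_zero] at h2
  refine le_of_tendsto_of_tendsto h1 h2 ?_
  filter_upwards [eventually_ge_atTop 1] with R hR
  -- The tail estimate for `Q = {p}` bounds `1 - a(p)` by `C * N(p)⁻²` as `R → ∞`.
  have h3 := h {p} ((Ideal.absNorm p.asIdeal : ℝ) ^ 2)⁻¹ (by simpa using hp) (fun F hF => ?_) R hR
  · refine le_trans (proportion_mono hν ?_ R) h3
    intro b hb
    simpa using hb
  · refine (Finset.sum_le_sum_of_subset_of_nonneg (t := {p}) ?_ fun _ _ _ => by positivity).trans
      (by simp)
    exact_mod_cast hF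

/-- The sieve: the density of the `b ∈ T` at which the product is squarefree away from `S`. -/
theorem exists_tendsto_proportion_squarefreeAway (hν : IsEmbeddingNorm ν)
    {S : Finset (HeightOneSpectrum (𝓞 K))} {T : Set (𝓞 K)} (hT : DefinedByCongruencesAt S T)
    (hTne : T.Nonempty) (hA : Squarefree ((prodLinear c d).map (algebraMap (𝓞 K) K)))
    (hmul : Multipliable (fun p : {p : HeightOneSpectrum (𝓞 K) // p ∉ S} =>
        localDensity (prodLinear c d) p.1)) :
    ∃ δ : ℝ, 0 < δ ∧ Tendsto (proportion ν T) atTop (𝓝 δ) ∧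
      Tendsto (proportion ν {b | b ∈ T ∧ SquarefreeAway S ((prodLinear c d).eval b)}) atTop
        (𝓝 (δ * ∏' p : {p : HeightOneSpectrum (𝓞 K) // p ∉ S},
          localDensity (prodLinear c d) p.1)) := by
  classical
  set A := prodLinear c d with hAdef
  obtain ⟨δ, hδ, hfinite⟩ := exists_tendsto_proportion_inter hν hT hTne A
  refine ⟨δ, hδ, by simpa using hfinite ∅ (Finset.disjoint_empty_left S), ?_⟩
  obtain ⟨B, C, E, hC, hE, htail⟩ := exists_proportion_le_of_sum_le hν hA
  set Λ : ℝ := ∏' p : {p : HeightOneSpectrum (𝓞 K) // p ∉ S}, localDensity A p.1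
  refine Metric.tendsto_nhds.2 fun ε hε => ?_
  have hprod : Tendsto (fun P : Finset {p : HeightOneSpectrum (𝓞 K) // p ∉ S} =>
      δ * ∏ p ∈ P, localDensity A p.1) atTop (𝓝 (δ * Λ)) := hmul.hasProd.const_mul δ
  -- The error `ε` is split into quarters: truncating the product, the limit for finitely many
  -- primes, the tail sum and `E R`. The denominator has `C + 1` because `C` may be 0.
  obtain ⟨P₁, hP₁⟩ := (Metric.tendsto_atTop.1 hprod) (ε / 4) (by positivity)
  obtain ⟨P₂, hP₂⟩ := summable_iff_vanishing_norm.1 (summable_absNorm_inv_sq (K := K))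
    (ε / (4 * (C + 1))) (by positivity)
  set P : Finset {p : HeightOneSpectrum (𝓞 K) // p ∉ S} :=
    P₁ ∪ (P₂ ∪ B).subtype (fun p => p ∉ S) with hP
  set P' : Finset (HeightOneSpectrum (𝓞 K)) := P.map (Function.Embedding.subtype _) with hP'
  have hP'S : Disjoint P' S := by
    rw [Finset.disjoint_left]
    intro p hp
    obtain ⟨p', -, rfl⟩ := Finset.mem_map.1 hp
    exact p'.2
  have hlim := hfinite P' hP'S
  rw [hP', Finset.prod_map] at hlim
  have hPΛ : dist (δ * ∏ p ∈ P, localDensity A p.1) (δ * Λ) < ε / 4 :=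
    hP₁ P Finset.subset_union_left
  set Q : Set (HeightOneSpectrum (𝓞 K)) := {p | p ∉ S ∧ p ∉ P'} with hQ
  have hQP : ∀ p ∈ Q, p ∉ P₂ ∪ B := by
    rintro p ⟨hpS, hpP⟩ hmem
    refine hpP (Finset.mem_map.2 ⟨⟨p, hpS⟩, ?_, rfl⟩)
    exact Finset.mem_union_right _ (Finset.mem_subtype.2 hmem)
  have hQtail := htail Q (ε / (4 * (C + 1)))
    (fun p hp hpB => hQP p hp (Finset.mem_union_right _ hpB)) (fun F hF => by
      refine (le_abs_self _).trans (hP₂ F ?_).le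
      exact Finset.disjoint_left.2 fun p hp hp2 => hQP p (hF hp) (Finset.mem_union_left _ hp2))
  have hCε : C * (ε / (4 * (C + 1))) ≤ ε / 4 := by
    rw [mul_div_assoc', div_le_div_iff₀ (by positivity) (by positivity)]
    nlinarith
  filter_upwards [(Metric.tendsto_nhds.1 hlim) (ε / 4) (by positivity),
    hE.eventually_lt_const (show (0 : ℝ) < ε / 4 by positivity),
    eventually_ge_atTop 1] with R h1 h2 hR
  have h3 := hQtail R hR
  set X₀ : Set (𝓞 K) := {b | b ∈ T ∧ SquarefreeAway S (A.eval b)} with hX₀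
  set X₁ : Set (𝓞 K) := {b | b ∈ T ∧ ∀ p ∈ P', A.eval b ∉ p.asIdeal ^ 2} with hX₁
  -- `X₀ ⊆ X₁`, and `X₁` exceeds `X₀` only by integers that are bad at a prime of `Q`.
  have h4 : proportion ν X₀ R ≤ proportion ν X₁ R := by
    refine proportion_mono hν ?_ R
    rintro b ⟨hb, hsq⟩
    rw [squarefreeAway_iff] at hsq
    exact ⟨hb, fun p hp => hsq p (Finset.disjoint_left.1 hP'S hp)⟩
  have h5 : proportion ν X₁ R ≤ proportion ν X₀ R +
      proportion ν {b | ∃ p ∈ Q, A.eval b ∈ p.asIdeal ^ 2} R := by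
    refine (proportion_mono hν ?_ R).trans (proportion_union_le _ _ _)
    rintro b ⟨hb, hP⟩
    by_cases hsq : SquarefreeAway S (A.eval b)
    · exact Or.inl ⟨hb, hsq⟩
    · rw [squarefreeAway_iff] at hsq
      push Not at hsq
      obtain ⟨p, hpS, hp⟩ := hsq
      exact Or.inr ⟨p, ⟨hpS, fun hpP => hP p hpP hp⟩, hp⟩
  rw [Real.dist_eq, abs_lt] at h1 hPΛ ⊢
  simp only [Function.Embedding.coe_subtype] at h1
  constructor <;> linarith [h1.1, h1.2, hPΛ.1, hPΛ.2]

end Sieve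

/-! ### From `size` to norms, and the main theorem -/

/-- The sets `size q b ≤ N` are balls of the `ℓ^q` norm of the embeddings. -/
theorem exists_isEmbeddingNorm_size {q : ℕ} (hq : q = 1 ∨ q = 2) :
    ∃ (ν : AddGroupSeminorm (𝓞 K)) (r : ℝ → ℝ), IsEmbeddingNorm ν ∧ Tendsto r atTop atTop ∧
      ∀ N : ℝ, 0 ≤ N → ∀ b : 𝓞 K, size q (b : K) ≤ N ↔ ν b ≤ r N := by
  have : Fact (1 ≤ (q : ENNReal)) := ⟨by rcases hq with rfl | rfl <;> norm_num⟩
  rcases hq with rfl | rfl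
  -- For `q = 1` the `ℓ¹` norm is the square of `size`, whence the radius `N ^ 2`.
  · refine ⟨embeddingNorm 1, fun N => N ^ 2, isEmbeddingNorm_embeddingNorm 1,
      tendsto_pow_atTop two_ne_zero, fun N hN b => ?_⟩
    have h : embeddingNorm 1 b = ∑ σ : K →+* ℂ, ‖σ (b : K)‖ := by
      rw [embeddingNorm_apply, PiLp.norm_eq_sum (by simp)]
      simp
    rw [h, size, Real.sqrt_le_left hN]
    simp
  · refine ⟨embeddingNorm 2, fun N => N, isEmbeddingNorm_embeddingNorm 2,
      tendsto_id, fun N hN b => ?_⟩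
    have h : embeddingNorm 2 b = size 2 (b : K) := by
      rw [embeddingNorm_apply, PiLp.norm_eq_sum (by simp), size, Real.sqrt_eq_rpow]
      simp
    rw [h]

end SquarefreeSieve

end

theorem mainTheorem5 {K : Type*} [Field K] [NumberField K]
    (S : Finset (HeightOneSpectrum (𝓞 K))) (T : Set (𝓞 K))
    (hT : SquarefreeSieve.DefinedByCongruencesAt S T) (hTne : T.Nonempty)
    {k : ℕ} (c d : Fin k → 𝓞 K)
    (hA : Squarefree ((SquarefreeSieve.prodLinear c d).map (algebraMap (𝓞 K) K)))
    (q : ℕ) (hq : q = 1 ∨ q = 2) :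
    Multipliable (fun p : {p : HeightOneSpectrum (𝓞 K) // p ∉ S} =>
        SquarefreeSieve.localDensity (SquarefreeSieve.prodLinear c d) p.1) ∧
    Tendsto (fun N : ℝ =>
        (Set.ncard {b : 𝓞 K | b ∈ T ∧ SquarefreeSieve.size q (b : K) ≤ N ∧
          SquarefreeSieve.SquarefreeAway S ((SquarefreeSieve.prodLinear c d).eval b)} : ℝ) /
        (Set.ncard {b : 𝓞 K | b ∈ T ∧ SquarefreeSieve.size q (b : K) ≤ N} : ℝ))
      atTop
      (𝓝 (∏' p : {p : HeightOneSpectrum (𝓞 K) // p ∉ S},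
        SquarefreeSieve.localDensity (SquarefreeSieve.prodLinear c d) p.1)) ∧
    ((∀ p : HeightOneSpectrum (𝓞 K), p ∉ S →
        0 < SquarefreeSieve.localDensity (SquarefreeSieve.prodLinear c d) p) →
      0 < ∏' p : {p : HeightOneSpectrum (𝓞 K) // p ∉ S},
        SquarefreeSieve.localDensity (SquarefreeSieve.prodLinear c d) p.1) := by
  obtain ⟨ν, r, hν, hr, hsize⟩ := SquarefreeSieve.exists_isEmbeddingNorm_size (K := K) hq
  have hsum : Summable (fun p : {p : HeightOneSpectrum (𝓞 K) // p ∉ S} =>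
      ‖SquarefreeSieve.localDensity (SquarefreeSieve.prodLinear c d) p.1 - 1‖) :=
    (SquarefreeSieve.summable_norm_localDensity_sub_one hν hA).comp_injective
      Subtype.val_injective
  have hmul : Multipliable (fun p : {p : HeightOneSpectrum (𝓞 K) // p ∉ S} =>
      SquarefreeSieve.localDensity (SquarefreeSieve.prodLinear c d) p.1) := by
    simpa using multipliable_one_add_of_summable hsum
  refine ⟨hmul, ?_, fun hpos => ?_⟩
  · obtain ⟨δ, hδ, hTδ, hlim⟩ :=
      SquarefreeSieve.exists_tendsto_proportion_squarefreeAway hν hT hTne hA hmul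
    -- The density `δ` of `T` cancels in the quotient of the two proportions.
    have h := (hlim.div hTδ hδ.ne').comp hr
    rw [mul_div_cancel_left₀ _ hδ.ne'] at h
    refine h.congr' ?_
    filter_upwards [eventually_ge_atTop 0, hr.eventually_ge_atTop 0] with N hN hrN
    have hG := hν.ncard_ball_pos hrN
    simp only [Function.comp_apply, Pi.div_apply, SquarefreeSieve.proportion]
    rw [div_div_div_cancel_right₀ (by exact_mod_cast hG.ne')]
    congr 3
    · ext b
      simp only [Set.mem_inter_iff, Set.mem_ofPred_eq, hsize N hN b]
      tauto
    · ext b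
      simp only [Set.mem_inter_iff, Set.mem_ofPred_eq, hsize N hN b]
  · have h0 : 0 ≤ ∏' p : {p : HeightOneSpectrum (𝓞 K) // p ∉ S},
        SquarefreeSieve.localDensity (SquarefreeSieve.prodLinear c d) p.1 :=
      ge_of_tendsto' hmul.hasProd fun P =>
        Finset.prod_nonneg fun p _ => SquarefreeSieve.localDensity_nonneg _ p.1
    refine h0.lt_of_ne' ?_
    -- An absolutely convergent product of nonzero factors is nonzero.
    have h1 := tprod_one_add_ne_zero_of_summable
      (f := fun p : {p : HeightOneSpectrum (𝓞 K) // p ∉ S} =>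
        SquarefreeSieve.localDensity (SquarefreeSieve.prodLinear c d) p.1 - 1)
      (fun p => by simpa using (hpos p.1 p.2).ne') hsum
    simpa using h1
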